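/- For $n\ge 1$ let $B_n$ be the number of partitions of an $n$-element set into nonempty blocks, let $B_{n,1}$ be the number of those partitions that have no block of size $1$, and let $r=r(n)$ be the unique real solution of $re^{r}=n$. Then, as $n\to\infty$, $$\frac{B_{n,1}}{B_n}=\frac{r}{n}\left(1+O\left(\frac{\log n}{n}\right)\right)$$ and $$\frac{B_{n,1}}{B_n}=\frac{\log(n/\log n)}{n}\left(1+O\left(\frac{\log\log n}{(\log n)^2}\right)\right),$$ where the implied constants are absolute. -/

import Mathlib

open Filter Asymptotics

/-- `B_n`: the number of partitions of an `n`-element set (into nonempty blocks). -/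
def numSetPartitions (n : ℕ) : ℕ :=
  Fintype.card (Finpartition (Finset.univ : Finset (Fin n)))

/-- `B_{n,m}`: the number of `m`-rough partitions of an `n`-element set, that is, of those
partitions all of whose blocks have more than `m` elements. -/
def numRoughPartitions (n m : ℕ) : ℕ :=
  Fintype.card {P : Finpartition (Finset.univ : Finset (Fin n)) // ∀ b ∈ P.parts, m < b.card}

/-- For every natural number `n`, the equation `r e ^ r = n` has exactly one real solution. -/
theorem existsUnique_mul_exp_eq (n : ℕ) : ∃! r : ℝ, r * Real.exp r = n := by
  have hn : (0 : ℝ) ≤ n := Nat.cast_nonneg n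
  have hc : ContinuousOn (fun x : ℝ => x * Real.exp x) (Set.Icc 0 (n : ℝ)) := by fun_prop
  have hmem : (n : ℝ) ∈ Set.Icc ((0 : ℝ) * Real.exp 0) ((n : ℝ) * Real.exp n) :=
    ⟨by simp, le_mul_of_one_le_right hn (Real.one_le_exp hn)⟩
  obtain ⟨r, -, hr⟩ := intermediate_value_Icc hn hc hmem
  have nonneg : ∀ x : ℝ, x * Real.exp x = n → 0 ≤ x := fun x hx =>
    nonneg_of_mul_nonneg_left (hx ▸ hn) (Real.exp_pos x)
  have lt_of : ∀ x y : ℝ, 0 ≤ x → x < y → x * Real.exp x < y * Real.exp y := fun x y hx hxy =>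
    mul_lt_mul hxy (Real.exp_le_exp.2 hxy.le) (Real.exp_pos x) (hx.trans hxy.le)
  refine ⟨r, hr, fun y hy => ?_⟩
  have hr' : r * Real.exp r = n := hr
  rcases lt_trichotomy y r with h | h | h
  · have := lt_of y r (nonneg y hy) h
    linarith
  · exact h
  · have := lt_of r y (nonneg r hr') h
    linarith

/-- `r(n)`: the real solution `r` of `r e ^ r = n` (the Lambert `W` function at `n`). -/
noncomputable def lambertR (n : ℕ) : ℝ := (existsUnique_mul_exp_eq n).choose

theorem lambertR_mul_exp (n : ℕ) : lambertR n * Real.exp (lambertR n) = n :=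
  (existsUnique_mul_exp_eq n).choose_spec.1

/-! Write `V n` for the number of singleton-free partitions, `B n` for the Bell number and `a n = B
(n+1) / B n`. The identity `V (n+1) + V n = B n` shows that `V n / B n` is `1 / a (n-1)` up to a
relative error `O(1 / a (n-1))`, so it is enough to locate `a (n-1)` within `O(1)` of `e ^ r = n /
r`.

This needs no saddle-point analysis. In the recurrence for `B (n+1)`, log-concavity of `B n / n!`
bounds the earlier terms above by a geometric progression, which gives `a n * log (a n) ≤ n + 1`.
Log-convexity of `B n` bounds them below in the same way and gives `a n * log (a n) ≥ n - n / (2 * a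
n)`. Since `e ^ r` solves `x * log x = n`, it follows that `e ^ r - 2 ≤ a (n-1) ≤ e ^ r` once `r ≥
2`. The second estimate then follows from `r + log r = log n`. -/

section Counting

/-! ### Recurrence for set partitions with restricted block sizes -/

variable {α : Type*} [DecidableEq α]

/-- The number of partitions of `s` all of whose blocks have a size satisfying `p`. -/
def countPartitions (p : ℕ → Prop) [DecidablePred p] (s : Finset α) : ℕ :=
  (Finset.univ.filter fun P : Finpartition s => ∀ b ∈ P.parts, p b.card).card

theorem countPartitions_empty (p : ℕ → Prop) [DecidablePred p] :
    countPartitions p (∅ : Finset α) = 1 := by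
  have h : ∀ P : Finpartition (∅ : Finset α), P.parts = ∅ := fun P =>
    P.parts_eq_empty_iff.2 rfl
  rw [countPartitions, Finset.filter_true_of_mem fun P _ b hb => by simp [h P] at hb]
  exact Finset.card_eq_one.2 ⟨⊤, Finset.ext fun P => by
    simpa using Finpartition.ext ((h P).trans (h ⊤).symm)⟩

/-- Deleting the block `insert a t` is a bijection onto the admissible partitions of `s \ t`; its
inverse is `Finpartition.extend`. -/
theorem card_filter_part_erase_eq (p : ℕ → Prop) [DecidablePred p] {a : α} {s t : Finset α}
    (ha : a ∉ s) (ht : t ⊆ s) (hp : p (t.card + 1)) :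
    ((Finset.univ.filter fun P : Finpartition (insert a s) => ∀ b ∈ P.parts, p b.card).filter
      fun P => (P.part a).erase a = t).card = countPartitions p (s \ t) := by
  have hat : a ∉ t := fun h => ha (ht h)
  have hd : Disjoint (s \ t) (insert a t) := by
    rw [Finset.disjoint_left]; intro x hx; simp only [Finset.mem_sdiff] at hx
    simp only [Finset.mem_insert]; rintro (rfl | h)
    exacts [ha hx.1, hx.2 h]
  have hu : (s \ t) ⊔ insert a t = insert a s := by
    ext x; simp only [Finset.sup_eq_union, Finset.mem_union, Finset.mem_sdiff, Finset.mem_insert]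
    have := @ht x; tauto
  have hne : insert a t ≠ (⊥ : Finset α) := (Finset.insert_nonempty a t).ne_empty
  symm
  refine Finset.card_bij (fun P _ => P.extend hne hd hu) ?_ ?_ ?_
  · intro P hP
    have hP' : ∀ b ∈ P.parts, p b.card := by simpa using hP
    simp only [Finset.mem_filter, Finset.mem_univ, true_and, Finpartition.extend_parts]
    refine ⟨fun b hb => ?_, ?_⟩
    · rcases Finset.mem_insert.1 hb with rfl | hb
      · rwa [Finset.card_insert_of_notMem hat]
      · exact hP' b hb
    · rw [Finpartition.part_eq_of_mem _ (t := insert a t) (by simp) (by simp),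
        Finset.erase_insert hat]
  · intro P _ Q _ h
    have key : ∀ P : Finpartition (s \ t), (insert a t) ∉ P.parts := fun P hP =>
      ha (Finset.mem_sdiff.1 (P.le hP (Finset.mem_insert_self a t))).1
    have h' : insert (insert a t) P.parts = insert (insert a t) Q.parts := congrArg (·.parts) h
    apply Finpartition.ext
    rw [← Finset.erase_insert (key P), h', Finset.erase_insert (key Q)]
  · intro P hP
    simp only [Finset.mem_filter, Finset.mem_univ, true_and] at hP
    obtain ⟨hP, hPt⟩ := hP
    have has : a ∈ insert a s := Finset.mem_insert_self a s
    have hpart : P.part a = insert a t := by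
      rw [← hPt, Finset.insert_erase (P.mem_part has)]
    have hmem : insert a t ∈ P.parts := hpart ▸ P.part_mem.2 has
    have hsup : (P.parts.erase (insert a t)).sup id = s \ t := by
      ext x
      simp only [Finset.mem_sup, Finset.mem_erase, id, Finset.mem_sdiff]
      constructor
      · rintro ⟨b, ⟨hb, hbP⟩, hx⟩
        have hxt : x ∉ insert a t := fun h => hb (P.eq_of_mem_parts hbP hmem hx h)
        have hxs := P.le hbP hx
        rw [Finset.mem_insert] at hxt
        have hxs' := Finset.mem_insert.1 hxs
        tauto
      · rintro ⟨hxs, hxt⟩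
        obtain ⟨b, hb, hx⟩ := P.exists_mem (Finset.mem_insert_of_mem hxs : x ∈ insert a s)
        refine ⟨b, ⟨?_, hb⟩, hx⟩
        rintro rfl
        rcases Finset.mem_insert.1 hx with rfl | h
        exacts [ha hxs, hxt h]
    refine ⟨P.ofSubset (Finset.erase_subset _ _) hsup, ?_, ?_⟩
    · simp only [Finset.mem_filter, Finset.mem_univ, true_and]
      exact fun b hb => hP b (Finset.mem_of_mem_erase hb)
    · exact Finpartition.ext (Finset.insert_erase hmem)

theorem countPartitions_insert (p : ℕ → Prop) [DecidablePred p] {a : α} {s : Finset α}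
    (ha : a ∉ s) :
    countPartitions p (insert a s) =
      ∑ t ∈ s.powerset, if p (t.card + 1) then countPartitions p (s \ t) else 0 := by
  rw [countPartitions, Finset.card_eq_sum_card_fiberwise (f := fun P => (P.part a).erase a)
    (t := s.powerset)]
  · refine Finset.sum_congr rfl fun t ht => ?_
    split_ifs with hp
    · exact card_filter_part_erase_eq p ha (Finset.mem_powerset.1 ht) hp
    · rw [Finset.card_eq_zero, Finset.filter_eq_empty_iff]
      rintro P hP rfl
      simp only [Finset.mem_filter, Finset.mem_univ, true_and] at hP
      have has : a ∈ insert a s := Finset.mem_insert_self a s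
      refine hp ?_
      rw [Finset.card_erase_add_one (P.mem_part has)]
      exact hP _ (P.part_mem.2 has)
  · intro P _
    simp only [Finset.coe_powerset, Set.mem_preimage, Set.mem_powerset_iff, Finset.coe_subset]
    rw [← Finset.subset_insert_iff]
    exact P.part_subset a

/-- Keeping `p` general lets one argument serve both the Bell numbers and the singleton-free count.
-/
theorem countPartitions_eq_of_recurrence (p : ℕ → Prop) [DecidablePred p] (f : ℕ → ℕ)
    (h0 : f 0 = 1)
    (hf : ∀ n, f (n + 1) =
      ∑ j ∈ Finset.range (n + 1), n.choose j * if p (j + 1) then f (n - j) else 0)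
    (s : Finset α) : countPartitions p s = f s.card := by
  induction s using Finset.strongInduction with
  | H s ih =>
    rcases s.eq_empty_or_nonempty with rfl | ⟨a, has⟩
    · rw [countPartitions_empty, Finset.card_empty, h0]
    · have ha := Finset.notMem_erase a s
      have hlt := Finset.erase_ssubset has
      conv_lhs => rw [← Finset.insert_erase has]
      have hsum := Finset.sum_powerset_apply_card
        (fun j => if p (j + 1) then f ((s.erase a).card - j) else 0) (x := s.erase a)
      simp only [smul_eq_mul] at hsum
      rw [countPartitions_insert p ha, ← Finset.card_erase_add_one has, hf, ← hsum]
      refine Finset.sum_congr rfl fun t ht => ?_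
      split_ifs
      · rw [ih _ (Finset.sdiff_subset.trans_ssubset hlt),
          Finset.card_sdiff_of_subset (Finset.mem_powerset.1 ht)]
      · rfl

end Counting

/-! ### Singleton-free partitions and Bell numbers -/

/-- The number of partitions of an `n`-element set without blocks of size `1`, through the
recurrence on the block of a distinguished element. -/
def singletonFreeBell : ℕ → ℕ
  | 0 => 1
  | n + 1 => ∑ j : Fin (n + 1), n.choose j * if 1 < (j : ℕ) + 1 then singletonFreeBell (n - j) else 0

theorem singletonFreeBell_succ (n : ℕ) : singletonFreeBell (n + 1) =
    ∑ j ∈ Finset.range (n + 1), n.choose j * if 1 < j + 1 then singletonFreeBell (n - j) else 0 := by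
  rw [singletonFreeBell]
  exact Fin.sum_univ_eq_sum_range
    (fun j => n.choose j * if 1 < j + 1 then singletonFreeBell (n - j) else 0) (n + 1)

theorem numRoughPartitions_one_eq (n : ℕ) : numRoughPartitions n 1 = singletonFreeBell n := by
  have h := countPartitions_eq_of_recurrence (α := Fin n) (fun k => 1 < k) singletonFreeBell
    (by rw [singletonFreeBell]) singletonFreeBell_succ Finset.univ
  rw [Finset.card_univ, Fintype.card_fin] at h
  rw [← h, numRoughPartitions, countPartitions, Fintype.card_subtype]
  congr!

theorem Nat.bell_succ_range (n : ℕ) :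
    Nat.bell (n + 1) = ∑ j ∈ Finset.range (n + 1), n.choose j * Nat.bell (n - j) := by
  rw [Nat.bell_succ, ← Nat.range_succ_eq_Iic]

theorem numSetPartitions_eq_bell (n : ℕ) : numSetPartitions n = Nat.bell n := by
  have h := countPartitions_eq_of_recurrence (α := Fin n) (fun _ => True) Nat.bell
    Nat.bell_zero (by simpa using Nat.bell_succ_range) Finset.univ
  rw [Finset.card_univ, Fintype.card_fin] at h
  rw [← h, numSetPartitions, countPartitions]
  simp

/-- The recurrence omits only the term `j = 0`, which would be `singletonFreeBell n`; adding it back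
completes the binomial sum. -/
theorem singletonFreeBell_succ_add (n : ℕ) : singletonFreeBell (n + 1) + singletonFreeBell n =
    ∑ j ∈ Finset.range (n + 1), n.choose j * singletonFreeBell j := by
  rw [← Finset.sum_range_reflect, singletonFreeBell_succ, Finset.sum_range_succ',
    Finset.sum_range_succ' (n := n)]
  simp only [lt_self_iff_false, zero_add, if_false, mul_zero, add_zero]
  refine congrArg₂ _ (Finset.sum_congr rfl fun j hj => ?_) (by simp)
  have hj := Finset.mem_range.1 hj
  rw [if_pos (by omega), show n + 1 - 1 - (j + 1) = n - (j + 1) by omega, Nat.choose_symm (by omega)]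

/-- A partition is fixed by the set of elements outside singleton blocks and a singleton-free
partition of that set. The induction uses Pascal's rule to reach the Bell recurrence. -/
theorem sum_choose_mul_singletonFreeBell (n : ℕ) :
    ∑ j ∈ Finset.range (n + 1), n.choose j * singletonFreeBell j = Nat.bell n := by
  induction n using Nat.strong_induction_on with
  | _ n ih =>
    rcases n with _ | n
    · simp [singletonFreeBell]
    · have h1 : ∑ j ∈ Finset.range (n + 2), (n + 1).choose j * singletonFreeBell j =
          ∑ j ∈ Finset.range (n + 1),
            n.choose j * (singletonFreeBell (j + 1) + singletonFreeBell j) := by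
        rw [Finset.sum_range_succ']
        simp only [Nat.choose_succ_succ', add_mul, mul_add, Finset.sum_add_distrib]
        rw [Finset.sum_range_succ' (fun j => n.choose j * singletonFreeBell j),
          Finset.sum_range_succ (fun j => n.choose (j + 1) * singletonFreeBell (j + 1))]
        simp
        ring
      rw [h1, Nat.bell_succ_range, ← Finset.sum_range_reflect]
      refine Finset.sum_congr rfl fun j hj => ?_
      have hj := Finset.mem_range.1 hj
      rw [show n + 1 - 1 - j = n - j by omega, Nat.choose_symm (by omega),
        singletonFreeBell_succ_add, ih _ (by omega)]

theorem singletonFreeBell_succ_add_eq_bell (n : ℕ) :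
    singletonFreeBell (n + 1) + singletonFreeBell n = Nat.bell n := by
  rw [singletonFreeBell_succ_add, sum_choose_mul_singletonFreeBell]

/-! ### Log-concavity of `B n / n!` -/

/-- Chebyshev's sum inequality, by symmetrising in `(i, l)`: each symmetrised term is a product of
two factors of equal sign. The cross-multiplied hypotheses allow zero entries. -/
theorem sum_mul_sum_le_sum_mul_sum_of_ratio_antitone (n : ℕ) (z w u v : ℕ → ℝ)
    (hzw : ∀ i l, i ≤ l → l < n → z i * w l ≤ z l * w i)
    (huv : ∀ i l, i ≤ l → l < n → u i * v l ≤ u l * v i) :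
    (∑ i ∈ Finset.range n, z i * v i) * ∑ i ∈ Finset.range n, w i * u i ≤
      (∑ i ∈ Finset.range n, z i * u i) * ∑ i ∈ Finset.range n, w i * v i := by
  rw [← sub_nonneg]
  simp only [Finset.sum_mul_sum]
  rw [← Finset.sum_sub_distrib]
  simp only [← Finset.sum_sub_distrib]
  have hswap := Finset.sum_comm (s := Finset.range n) (t := Finset.range n)
    (f := fun i l => z i * u i * (w l * v l) - z i * v i * (w l * u l))
  have hnonneg : 0 ≤ ∑ i ∈ Finset.range n, ∑ l ∈ Finset.range n,
      ((z i * u i * (w l * v l) - z i * v i * (w l * u l)) +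
        (z l * u l * (w i * v i) - z l * v l * (w i * u i))) := by
    refine Finset.sum_nonneg fun i hi => Finset.sum_nonneg fun l hl => ?_
    have hi := Finset.mem_range.1 hi
    have hl := Finset.mem_range.1 hl
    have hfac : (z i * u i * (w l * v l) - z i * v i * (w l * u l)) +
        (z l * u l * (w i * v i) - z l * v l * (w i * u i)) =
        (z l * w i - z i * w l) * (u l * v i - u i * v l) := by ring
    rw [hfac]
    rcases le_total i l with h | h
    · exact mul_nonneg (sub_nonneg.2 (hzw i l h hl)) (sub_nonneg.2 (huv i l h hl))
    · exact mul_nonneg_of_nonpos_of_nonpos (sub_nonpos.2 (hzw l i h hi))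
        (sub_nonpos.2 (huv l i h hi))
  simp only [Finset.sum_add_distrib] at hnonneg
  rw [← hswap] at hnonneg
  linarith

theorem bell_pos (n : ℕ) : 0 < Nat.bell n := by
  induction n with
  | zero => simp
  | succ n ih =>
    rw [Nat.bell_succ_range]
    exact Finset.sum_pos' (fun _ _ => Nat.zero_le _) ⟨0, by simp, by simpa using ih⟩

/-- The coefficients of the exponential generating function of the Bell numbers. -/
noncomputable def bellDivFactorial (n : ℕ) : ℝ := Nat.bell n / n.factorial

theorem bellDivFactorial_pos (n : ℕ) : 0 < bellDivFactorial n :=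
  div_pos (mod_cast bell_pos n) (mod_cast n.factorial_pos)

theorem succ_mul_bellDivFactorial_succ (n : ℕ) :
    ((n : ℝ) + 1) * bellDivFactorial (n + 1) =
      ∑ j ∈ Finset.range (n + 1), 1 / (j.factorial : ℝ) * bellDivFactorial (n - j) := by
  have hn : (n.factorial : ℝ) ≠ 0 := mod_cast n.factorial_ne_zero
  have h1 : ((n : ℝ) + 1) * bellDivFactorial (n + 1) = Nat.bell (n + 1) / n.factorial := by
    rw [bellDivFactorial, Nat.factorial_succ]
    push_cast
    field_simp
  rw [h1, Nat.bell_succ_range]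
  push_cast
  rw [Finset.sum_div]
  refine Finset.sum_congr rfl fun j hj => ?_
  have hj : j ≤ n := Nat.lt_succ_iff.1 (Finset.mem_range.1 hj)
  have hj0 : (j.factorial : ℝ) ≠ 0 := mod_cast j.factorial_ne_zero
  have hnj : ((n - j).factorial : ℝ) ≠ 0 := mod_cast (n - j).factorial_ne_zero
  rw [bellDivFactorial, Nat.cast_choose ℝ hj]
  field_simp

/-- The weight `i` would give `n`; replacing it by `max i 1` adds the term `i = 0` and gives `n +
1`, so that the constants cancel exactly in the log-concavity step. -/
theorem sum_max_one_div_factorial_mul_bellDivFactorial (n : ℕ) :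
    ∑ i ∈ Finset.range (n + 1),
      (max i 1 : ℕ) / (i.factorial : ℝ) * bellDivFactorial (n - i) =
      ((n : ℝ) + 1) * bellDivFactorial n := by
  rcases n with _ | n
  · simp
  · rw [Finset.sum_range_succ']
    have h : ∀ i ∈ Finset.range (n + 1),
        (max (i + 1) 1 : ℕ) / ((i + 1).factorial : ℝ) * bellDivFactorial (n + 1 - (i + 1)) =
          1 / (i.factorial : ℝ) * bellDivFactorial (n - i) := by
      intro i _
      have hi : (i.factorial : ℝ) ≠ 0 := mod_cast i.factorial_ne_zero
      rw [max_eq_left (by omega), Nat.factorial_succ, Nat.add_sub_add_right]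
      push_cast
      field_simp
    rw [Finset.sum_congr rfl h, ← succ_mul_bellDivFactorial_succ]
    simp
    ring

/-- The four sums in Chebyshev's inequality are multiples of the three consecutive terms, with the
same factor `(m + 1) * (m + 2)` on both sides. -/
theorem bellDivFactorial_mul_le_sq (m : ℕ)
    (h : ∀ p q, p ≤ q → q ≤ m →
      bellDivFactorial (q + 1) * bellDivFactorial p ≤
        bellDivFactorial (p + 1) * bellDivFactorial q) :
    bellDivFactorial (m + 2) * bellDivFactorial m ≤
      bellDivFactorial (m + 1) * bellDivFactorial (m + 1) := by
  have key := sum_mul_sum_le_sum_mul_sum_of_ratio_antitone (m + 2)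
    (fun i => (max i 1 : ℕ) / (i.factorial : ℝ)) (fun i => 1 / (i.factorial : ℝ))
    (fun i => bellDivFactorial (m + 1 - i))
    (fun i => if i ≤ m then bellDivFactorial (m - i) else 0) ?_ ?_
  · rw [sum_max_one_div_factorial_mul_bellDivFactorial,
      ← succ_mul_bellDivFactorial_succ (m + 1), Finset.sum_range_succ _ (m + 1),
      Finset.sum_range_succ _ (m + 1)] at key
    have e1 : ∀ c : ℕ → ℝ, ∑ i ∈ Finset.range (m + 1),
        c i * (if i ≤ m then bellDivFactorial (m - i) else 0) =
        ∑ i ∈ Finset.range (m + 1), c i * bellDivFactorial (m - i) := fun c =>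
      Finset.sum_congr rfl fun i hi => by
        rw [if_pos (Nat.lt_succ_iff.1 (Finset.mem_range.1 hi))]
    rw [e1 (fun i => (max i 1 : ℕ) / (i.factorial : ℝ)), e1 (fun i => 1 / (i.factorial : ℝ)),
      sum_max_one_div_factorial_mul_bellDivFactorial, ← succ_mul_bellDivFactorial_succ,
      if_neg (by omega)] at key
    push_cast at key
    simp only [mul_zero, add_zero] at key
    have hc : (0 : ℝ) < ((m : ℝ) + 1) * (m + 1 + 1) := by positivity
    refine le_of_mul_le_mul_left ?_ hc
    linarith
  · intro i l hil _
    have : ((max i 1 : ℕ) : ℝ) ≤ (max l 1 : ℕ) := mod_cast max_le_max_right 1 hil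
    have h0 : (0 : ℝ) ≤ 1 / (i.factorial * l.factorial) := by positivity
    have := mul_le_mul_of_nonneg_right this h0
    calc _ = ((max i 1 : ℕ) : ℝ) * (1 / (i.factorial * l.factorial)) := by field_simp
      _ ≤ _ := this
      _ = _ := by field_simp
  · intro i l hil hl
    by_cases hlm : l ≤ m
    · simp only [if_pos hlm, if_pos (hil.trans hlm)]
      have := h (m - l) (m - i) (by omega) (by omega)
      rwa [show m - i + 1 = m + 1 - i by omega, show m - l + 1 = m + 1 - l by omega] at this
    · simp only [if_neg hlm, mul_zero]
      split_ifs
      · exact mul_nonneg (bellDivFactorial_pos _).le (bellDivFactorial_pos _).le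
      · simp

theorem bellDivFactorial_logConcave_of_le (m : ℕ) : ∀ p q, p ≤ q → q ≤ m →
    bellDivFactorial (q + 1) * bellDivFactorial p ≤
      bellDivFactorial (p + 1) * bellDivFactorial q := by
  induction m with
  | zero =>
    intro p q hpq hq
    obtain rfl : q = 0 := by omega
    obtain rfl : p = 0 := by omega
    exact le_rfl
  | succ m ih =>
    intro p q hpq hq
    rcases hq.lt_or_eq with hq | rfl
    · exact ih p q hpq (by omega)
    rcases hpq.lt_or_eq with hp | rfl
    · have h1 := bellDivFactorial_mul_le_sq m ih
      have h2 := ih p m (by omega) le_rfl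
      have hm := bellDivFactorial_pos m
      refine le_of_mul_le_mul_right ?_ hm
      calc bellDivFactorial (m + 1 + 1) * bellDivFactorial p * bellDivFactorial m
          = bellDivFactorial (m + 2) * bellDivFactorial m * bellDivFactorial p := by ring_nf
        _ ≤ bellDivFactorial (m + 1) * bellDivFactorial (m + 1) * bellDivFactorial p := by
            gcongr; exact (bellDivFactorial_pos p).le
        _ = bellDivFactorial (m + 1) * (bellDivFactorial (m + 1) * bellDivFactorial p) := by ring
        _ ≤ bellDivFactorial (m + 1) * (bellDivFactorial (p + 1) * bellDivFactorial m) := by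
            gcongr; exact (bellDivFactorial_pos _).le
        _ = _ := by ring
    · exact le_rfl

/-- The sequence `B_n / n!` is log-concave. -/
theorem bellDivFactorial_logConcave {p q : ℕ} (h : p ≤ q) :
    bellDivFactorial (q + 1) * bellDivFactorial p ≤
      bellDivFactorial (p + 1) * bellDivFactorial q :=
  bellDivFactorial_logConcave_of_le q p q h le_rfl

/-! ### Dobiński's formula and log-convexity of the Bell numbers -/

/-- Dobiński's formula. -/
theorem hasSum_pow_div_factorial_bell (n : ℕ) :
    HasSum (fun k : ℕ => (k : ℝ) ^ n / k.factorial) (Real.exp 1 * Nat.bell n) := by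
  induction n using Nat.strong_induction_on with
  | _ n ih =>
    rcases n with _ | n
    · have := NormedSpace.expSeries_div_hasSum_exp (1 : ℝ)
      rw [← Real.exp_eq_exp_ℝ] at this
      simpa using this
    · have h : HasSum (fun k : ℕ => ∑ j ∈ Finset.range (n + 1),
          (n.choose j : ℝ) * ((k : ℝ) ^ (n - j) / k.factorial))
          (∑ j ∈ Finset.range (n + 1), (n.choose j : ℝ) * (Real.exp 1 * Nat.bell (n - j))) :=
        hasSum_sum fun j _ => (ih (n - j) (by omega)).mul_left _
      -- The term `k = 0` vanishes; shifting `k` cancels one factor against the factorial and leaves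
      -- `(k + 1) ^ n` to expand.
      rw [← hasSum_nat_add_iff' 1]
      convert h using 1
      · rfl
      · funext k
        have hk : (k.factorial : ℝ) ≠ 0 := mod_cast k.factorial_ne_zero
        have : ((k : ℝ) + 1) ^ n = ∑ j ∈ Finset.range (n + 1), (k : ℝ) ^ (n - j) * n.choose j := by
          rw [add_comm, add_pow]
          simp
        calc _ = ((k : ℝ) + 1) ^ n / k.factorial := by
              rw [Nat.factorial_succ, pow_succ]; push_cast; field_simp
          _ = _ := by
              rw [this, Finset.sum_div]
              exact Finset.sum_congr rfl fun j _ => by ring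
      · rw [Nat.bell_succ_range]
        push_cast
        rw [Finset.mul_sum]
        simp only [Finset.range_one, Finset.sum_singleton, Nat.cast_zero, zero_pow n.succ_ne_zero,
          zero_div, sub_zero]
        exact Finset.sum_congr rfl fun j _ => by ring

/-- The Bell numbers are log-convex. -/
theorem bell_sq_le (n : ℕ) : (Nat.bell (n + 1) : ℝ) ^ 2 ≤ Nat.bell n * Nat.bell (n + 2) := by
  have hB : (0 : ℝ) < Nat.bell n := mod_cast bell_pos n
  -- `t` is the mean of `k` under the weights `k ^ n / k!`; log-convexity says that the variance is
  -- nonnegative.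
  set t : ℝ := Nat.bell (n + 1) / Nat.bell n with ht
  have h := ((hasSum_pow_div_factorial_bell (n + 2)).sub
    ((hasSum_pow_div_factorial_bell (n + 1)).mul_left (2 * t))).add
    ((hasSum_pow_div_factorial_bell n).mul_left (t ^ 2))
  have h0 := h.nonneg fun k => by
    have : (k : ℝ) ^ (n + 2) / k.factorial - 2 * t * ((k : ℝ) ^ (n + 1) / k.factorial) +
        t ^ 2 * ((k : ℝ) ^ n / k.factorial) = (k : ℝ) ^ n / k.factorial * (k - t) ^ 2 := by ring
    rw [this]
    positivity
  have h1 : Real.exp 1 * Nat.bell (n + 2) - 2 * t * (Real.exp 1 * Nat.bell (n + 1)) +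
      t ^ 2 * (Real.exp 1 * Nat.bell n) =
      Real.exp 1 / Nat.bell n * (Nat.bell n * Nat.bell (n + 2) - (Nat.bell (n + 1) : ℝ) ^ 2) := by
    rw [ht]
    field_simp
    ring
  rw [h1] at h0
  exact sub_nonneg.1 (nonneg_of_mul_nonneg_right h0 (by positivity))

/-! ### Bounds for the quotient of consecutive Bell numbers -/

/-- The quotient of consecutive Bell numbers. -/
noncomputable def bellRatio (n : ℕ) : ℝ := Nat.bell (n + 1) / Nat.bell n

theorem bellRatio_pos (n : ℕ) : 0 < bellRatio n :=
  div_pos (mod_cast bell_pos _) (mod_cast bell_pos _)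

theorem bellRatio_mul_bell (n : ℕ) : bellRatio n * Nat.bell n = Nat.bell (n + 1) :=
  div_mul_cancel₀ _ (mod_cast (bell_pos n).ne')

theorem bellRatio_monotone : Monotone bellRatio := by
  refine monotone_nat_of_le_succ fun n => ?_
  rw [bellRatio, bellRatio, div_le_div_iff₀ (mod_cast bell_pos _) (mod_cast bell_pos _)]
  have := bell_sq_le n
  linarith

theorem two_le_bellRatio_succ (n : ℕ) : 2 ≤ bellRatio (n + 1) := by
  refine le_trans (le_of_eq ?_) (bellRatio_monotone (Nat.le_add_left 1 n))
  have h1 : Nat.bell 1 = 1 := Nat.bell_one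
  have h2 : Nat.bell 2 = 2 := by
    rw [Nat.bell_succ_range]
    simp [Finset.sum_range_succ]
  rw [bellRatio, h1, h2]
  norm_num

theorem bellRatio_eq (n : ℕ) :
    bellRatio n = (n + 1) * (bellDivFactorial (n + 1) / bellDivFactorial n) := by
  have hn : (n.factorial : ℝ) ≠ 0 := mod_cast n.factorial_ne_zero
  have hB : (Nat.bell n : ℝ) ≠ 0 := mod_cast (bell_pos n).ne'
  rw [bellRatio, bellDivFactorial, bellDivFactorial, Nat.factorial_succ]
  push_cast
  field_simp

theorem bellRatio_succ_le (n : ℕ) : bellRatio (n + 1) ≤ 2 * bellRatio n := by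
  have h := bellDivFactorial_logConcave (Nat.le_succ n)
  have h' : bellDivFactorial (n + 1 + 1) / bellDivFactorial (n + 1) ≤
      bellDivFactorial (n + 1) / bellDivFactorial n := by
    rw [div_le_div_iff₀ (bellDivFactorial_pos _) (bellDivFactorial_pos _)]
    exact h
  have h0 : 0 ≤ bellDivFactorial (n + 1) / bellDivFactorial n :=
    (div_pos (bellDivFactorial_pos _) (bellDivFactorial_pos _)).le
  rw [bellRatio_eq, bellRatio_eq]
  push_cast
  calc _ ≤ ((n : ℝ) + 1 + 1) * (bellDivFactorial (n + 1) / bellDivFactorial n) := by gcongr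
    _ ≤ (2 * (n + 1)) * (bellDivFactorial (n + 1) / bellDivFactorial n) := by
        gcongr; linarith [(Nat.cast_nonneg n : (0 : ℝ) ≤ n)]
    _ = _ := by ring

/-- By log-concavity `bellDivFactorial (n - j) ≤ bellDivFactorial n * ρ⁻¹ ^ j`, so the recurrence is
dominated by the series of `exp (1 / ρ)`, where `1 / ρ = (n + 1) / bellRatio n`. -/
theorem bellRatio_mul_log_le (n : ℕ) : bellRatio n * Real.log (bellRatio n) ≤ n + 1 := by
  set ρ := bellDivFactorial (n + 1) / bellDivFactorial n with hρ
  have hb := bellDivFactorial_pos n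
  have hρ0 : 0 < ρ := div_pos (bellDivFactorial_pos _) hb
  have hstep : ∀ j, j ≤ n → bellDivFactorial (n - j) ≤ bellDivFactorial n * (1 / ρ) ^ j := by
    intro j
    induction j with
    | zero => simp
    | succ j ih =>
      intro hj
      have h := bellDivFactorial_logConcave (Nat.sub_le n (j + 1))
      rw [show n - (j + 1) + 1 = n - j by omega] at h
      have h' : bellDivFactorial (n - (j + 1)) ≤ bellDivFactorial (n - j) * (1 / ρ) := by
        rw [mul_one_div, le_div_iff₀ hρ0, hρ, mul_div_assoc', div_le_iff₀ hb]
        linarith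
      calc _ ≤ _ := h'
        _ ≤ bellDivFactorial n * (1 / ρ) ^ j * (1 / ρ) := by
            gcongr; exact ih (by omega)
        _ = _ := by ring
  have hsum : ((n : ℝ) + 1) * bellDivFactorial (n + 1) ≤
      bellDivFactorial n * Real.exp (1 / ρ) := by
    rw [succ_mul_bellDivFactorial_succ]
    calc _ ≤ ∑ j ∈ Finset.range (n + 1), bellDivFactorial n * ((1 / ρ) ^ j / j.factorial) := by
          refine Finset.sum_le_sum fun j hj => ?_
          have := hstep j (Nat.lt_succ_iff.1 (Finset.mem_range.1 hj))
          calc _ ≤ 1 / (j.factorial : ℝ) * (bellDivFactorial n * (1 / ρ) ^ j) := by gcongr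
            _ = _ := by ring
      _ ≤ _ := by
          rw [← Finset.mul_sum]
          gcongr
          exact Real.sum_le_exp_of_nonneg (by positivity) _
  have ha : bellRatio n ≤ Real.exp (1 / ρ) := by
    rw [bellRatio_eq, ← mul_div_assoc, div_le_iff₀ hb]
    linarith
  have hlog : Real.log (bellRatio n) ≤ 1 / ρ :=
    (Real.log_le_iff_le_exp (bellRatio_pos n)).2 ha
  calc _ ≤ bellRatio n * (1 / ρ) := by gcongr; exact (bellRatio_pos n).le
    _ = n + 1 := by rw [bellRatio_eq, ← hρ]; field_simp

/-- Log-convexity bounds `Nat.bell (n - j)` below by a geometric progression, and the binomial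
theorem sums it. -/
theorem one_add_inv_bellRatio_pow_le (n : ℕ) : (1 + 1 / bellRatio n) ^ n ≤ bellRatio n := by
  have ha := bellRatio_pos n
  have hB : (0 : ℝ) < Nat.bell n := mod_cast bell_pos n
  have hstep : ∀ j, j ≤ n → (Nat.bell n : ℝ) * (1 / bellRatio n) ^ j ≤ Nat.bell (n - j) := by
    intro j
    induction j with
    | zero => simp
    | succ j ih =>
      intro hj
      have h := bellRatio_mul_bell (n - (j + 1))
      rw [show n - (j + 1) + 1 = n - j by omega] at h
      have hm := bellRatio_monotone (Nat.sub_le n (j + 1))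
      calc _ = (Nat.bell n : ℝ) * (1 / bellRatio n) ^ j * (1 / bellRatio n) := by ring
        _ ≤ Nat.bell (n - j) * (1 / bellRatio n) := by gcongr; exact ih (by omega)
        _ ≤ Nat.bell (n - (j + 1)) := by
            rw [mul_one_div, div_le_iff₀ ha, ← h, mul_comm]
            gcongr
  refine le_of_mul_le_mul_right ?_ hB
  rw [bellRatio_mul_bell, Nat.bell_succ_range, add_comm, add_pow, Finset.sum_mul]
  push_cast
  refine Finset.sum_le_sum fun j hj => ?_
  have := hstep j (Nat.lt_succ_iff.1 (Finset.mem_range.1 hj))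
  calc _ = (n.choose j : ℝ) * (Nat.bell n * (1 / bellRatio n) ^ j) := by simp; ring
    _ ≤ _ := by gcongr

theorem le_bellRatio_mul_log (n : ℕ) :
    (n : ℝ) - n / (2 * bellRatio n) ≤ bellRatio n * Real.log (bellRatio n) := by
  have ha := bellRatio_pos n
  set a := bellRatio n with haa
  have h1 := Real.log_le_log (by positivity) (one_add_inv_bellRatio_pow_le n)
  rw [Real.log_pow] at h1
  -- The bound `log (1 + x) ≥ 2 * x / (x + 2)` loses only `n / (2 * a + 1)`, hence `O(1)` after
  -- division by `log a`.
  have h2 := Real.le_log_one_add_of_nonneg (x := 1 / a) (by positivity)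
  calc (n : ℝ) - n / (2 * a) ≤ a * (n * (2 * (1 / a) / (1 / a + 2))) := by
        have : a * (n * (2 * (1 / a) / (1 / a + 2))) = n - n / (2 * a + 1) := by
          field_simp; ring
        rw [this]
        gcongr
        linarith
    _ ≤ a * Real.log a := by
        gcongr
        exact (by gcongr : (n : ℝ) * (2 * (1 / a) / (1 / a + 2)) ≤ n * Real.log (1 + 1 / a)).trans h1

/-! ### Comparison with the solution of `r * e ^ r = n` -/

theorem lambertR_pos {n : ℕ} (hn : 1 ≤ n) : 0 < lambertR n := by
  have h := lambertR_mul_exp n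
  have hn' : (0 : ℝ) < n := by exact_mod_cast hn
  rw [← h] at hn'
  exact pos_of_mul_pos_left hn' (Real.exp_pos _).le

theorem log_lambertR_add {n : ℕ} (hn : 1 ≤ n) :
    Real.log (lambertR n) + lambertR n = Real.log n := by
  conv_rhs => rw [← lambertR_mul_exp n]
  rw [Real.log_mul (lambertR_pos hn).ne' (Real.exp_pos _).ne', Real.log_exp]

theorem log_le_two_mul_lambertR {n : ℕ} (hn : 1 ≤ n) : Real.log n ≤ 2 * lambertR n := by
  have h := log_lambertR_add hn
  have := Real.log_le_sub_one_of_pos (lambertR_pos hn)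
  linarith

theorem four_le_exp {r : ℝ} (hr : 2 ≤ r) : 4 ≤ Real.exp r := by
  have h1 := Real.add_one_le_exp (1 : ℝ)
  have h2 : Real.exp 2 = Real.exp 1 * Real.exp 1 := by rw [← Real.exp_add]; norm_num
  have h3 := Real.exp_le_exp.2 hr
  nlinarith

theorem sub_two_le_and_le_of_mul_log {a r : ℝ} {N : ℝ} (hr : 2 ≤ r) (hN : r * Real.exp r = N)
    (ha : 2 ≤ a) (hup : a * Real.log a ≤ N) (hlow : N - 1 - (N - 1) / (2 * a) ≤ a * Real.log a) :
    Real.exp r - 2 ≤ a ∧ a ≤ Real.exp r := by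
  set A := Real.exp r with hA
  have hA4 : 4 ≤ A := four_le_exp hr
  have hle : a ≤ A := by
    by_contra! h
    have hlog : r < Real.log a := (Real.lt_log_iff_exp_lt (by linarith)).2 h
    nlinarith
  have hlog : Real.log a ≤ r := (Real.log_le_iff_le_exp (by linarith)).2 hle
  have h1 : a * Real.log a ≤ a * r := by gcongr
  have h2 : (N - 1) / (2 * a) ≤ r * (A / (2 * a)) := by
    rw [← mul_div_assoc, hN]; gcongr; linarith
  have h3 : r * (A - a) ≤ r * (1 + A / (2 * a)) := by linarith
  have h4 : A - a ≤ 1 + A / (2 * a) := le_of_mul_le_mul_left h3 (by linarith)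
  -- Bootstrap: the crude `a ≥ 2` with `A ≥ 4` gives `a ≥ A / 2`, which turns the error `A / (2 *
  -- a)` into at most `1`.
  have h5 : A / (2 * a) ≤ A / 4 := by gcongr; linarith
  have h6 : A ≤ 2 * a := by linarith
  have h7 : A / (2 * a) ≤ 1 := (div_le_one (by linarith)).2 h6
  exact ⟨by linarith, hle⟩

theorem abs_mul_sub_one_le {A a q : ℝ} (hA : 4 ≤ A) (h1 : A - 2 ≤ a) (h2 : a ≤ A)
    (hq : 1 / a * (1 - 2 / a) ≤ q) (hq' : q ≤ 1 / a) :
    |q * A - 1| ≤ 4 / A := by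
  have ha : 0 < a := by linarith
  have hA0 : 0 < A := by linarith
  have h4 : 2 / a ≤ 4 / A := by rw [div_le_div_iff₀ ha hA0]; linarith
  have h5 : 2 / a ≤ 1 := (div_le_one ha).2 (by linarith)
  have h6 : 1 ≤ A / a := (one_le_div ha).2 h2
  rw [abs_le]
  constructor
  · have : 1 * (1 - 2 / a) ≤ q * A :=
      calc _ ≤ A / a * (1 - 2 / a) := by gcongr
        _ = 1 / a * (1 - 2 / a) * A := by ring
        _ ≤ _ := by gcongr
    linarith
  · have : q * A ≤ 1 + 4 / A :=
      calc _ ≤ 1 / a * A := by gcongr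
        _ ≤ 1 + 4 / A := by
            rw [one_div_mul_eq_div, div_le_iff₀ ha]
            have : (1 + 4 / A) * (A - 2) ≤ (1 + 4 / A) * a := by gcongr
            have e : (1 + 4 / A) * (A - 2) = A + (2 - 8 / A) := by field_simp; ring
            have : 8 / A ≤ 2 := by rw [div_le_iff₀ hA0]; linarith
            linarith
    linarith

/-- Here `V (n+2) = B (n+1) - V (n+1)` with `0 ≤ V (n+1) ≤ B n`, and `bellRatio_succ_le` controls `B
n / B (n+1)`. -/
theorem singletonFreeBell_div_bell_bounds (n : ℕ) :
    1 / bellRatio (n + 1) * (1 - 2 / bellRatio (n + 1)) ≤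
        (singletonFreeBell (n + 2) : ℝ) / Nat.bell (n + 2) ∧
      (singletonFreeBell (n + 2) : ℝ) / Nat.bell (n + 2) ≤ 1 / bellRatio (n + 1) := by
  have hB0 : (0 : ℝ) < Nat.bell n := mod_cast bell_pos _
  have hB1 : (0 : ℝ) < Nat.bell (n + 1) := mod_cast bell_pos _
  have hB2 : (0 : ℝ) < Nat.bell (n + 2) := mod_cast bell_pos _
  have e1 : (singletonFreeBell (n + 2) : ℝ) + singletonFreeBell (n + 1) = Nat.bell (n + 1) :=
    mod_cast singletonFreeBell_succ_add_eq_bell (n + 1)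
  have e2 : (singletonFreeBell (n + 1) : ℝ) + singletonFreeBell n = Nat.bell n :=
    mod_cast singletonFreeBell_succ_add_eq_bell n
  have p1 : (0 : ℝ) ≤ singletonFreeBell (n + 1) := Nat.cast_nonneg _
  have p0 : (0 : ℝ) ≤ singletonFreeBell n := Nat.cast_nonneg _
  have hinv : 1 / bellRatio (n + 1) = Nat.bell (n + 1) / Nat.bell (n + 2) := by
    rw [bellRatio, one_div_div]
  constructor
  · have h : (Nat.bell n : ℝ) / Nat.bell (n + 1) ≤ 2 / bellRatio (n + 1) := by
      rw [le_div_iff₀ (bellRatio_pos _)]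
      calc _ ≤ (Nat.bell n : ℝ) / Nat.bell (n + 1) * (2 * bellRatio n) := by
            gcongr; exact bellRatio_succ_le n
        _ = 2 := by rw [bellRatio]; field_simp
    calc _ ≤ 1 / bellRatio (n + 1) * (1 - (Nat.bell n : ℝ) / Nat.bell (n + 1)) := by
          gcongr; exact (one_div_pos.2 (bellRatio_pos _)).le
      _ = ((Nat.bell (n + 1) : ℝ) - Nat.bell n) / Nat.bell (n + 2) := by
          rw [hinv]; field_simp
      _ ≤ _ := by gcongr; linarith
  · rw [hinv]
    exact div_le_div_of_nonneg_right (by linarith) hB2.le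

theorem abs_ratio_mul_exp_lambertR_sub_one_le {n : ℕ} (hn : 2 ≤ n) (hr : 2 ≤ lambertR n) :
    |(singletonFreeBell n : ℝ) / Nat.bell n * Real.exp (lambertR n) - 1| ≤
      4 / Real.exp (lambertR n) := by
  obtain ⟨n, rfl⟩ := Nat.exists_eq_add_of_le' hn
  have hup := bellRatio_mul_log_le (n + 1)
  have hlow := le_bellRatio_mul_log (n + 1)
  obtain ⟨h1, h2⟩ := sub_two_le_and_le_of_mul_log hr (lambertR_mul_exp (n + 2))
    (two_le_bellRatio_succ n) (by push_cast at hup ⊢; linarith)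
    (by
      have e : (((n + 2 : ℕ) : ℝ)) - 1 = ((n + 1 : ℕ) : ℝ) := by push_cast; ring
      rw [e]; exact hlow)
  obtain ⟨hq, hq'⟩ := singletonFreeBell_div_bell_bounds n
  have h4 : 4 ≤ Real.exp (lambertR (n + 2)) := four_le_exp hr
  exact abs_mul_sub_one_le h4 h1 h2 hq hq'

/-! ### Asymptotic estimates -/

theorem tendsto_log_natCast_atTop : Tendsto (fun n : ℕ => Real.log n) atTop atTop :=
  Real.tendsto_log_atTop.comp tendsto_natCast_atTop_atTop

theorem eventually_abs_ratio_error_le : ∀ᶠ n : ℕ in atTop,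
    |(singletonFreeBell n : ℝ) / Nat.bell n * (n / lambertR n) - 1| ≤
      4 * (Real.log n / n) := by
  filter_upwards [tendsto_log_natCast_atTop.eventually_ge_atTop 4, eventually_ge_atTop 2]
    with n hlog hn
  have hn1 : 1 ≤ n := by omega
  have hr : 2 ≤ lambertR n := by linarith [log_le_two_mul_lambertR hn1]
  have hr0 := lambertR_pos hn1
  have hexp : Real.exp (lambertR n) = n / lambertR n := by
    rw [eq_div_iff hr0.ne', mul_comm, lambertR_mul_exp]
  have h := abs_ratio_mul_exp_lambertR_sub_one_le hn hr
  rw [hexp] at h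
  refine h.trans ?_
  have hle : lambertR n ≤ Real.log n := by
    rw [← log_lambertR_add hn1]
    linarith [Real.log_nonneg (by linarith : 1 ≤ lambertR n)]
  calc 4 / (n / lambertR n) = 4 * (lambertR n / n) := by field_simp
    _ ≤ _ := by gcongr

theorem eventually_log_div_le : ∀ᶠ n : ℕ in atTop,
    Real.log n / n ≤ Real.log (Real.log n) / Real.log n ^ 2 := by
  have h1 : ∀ᶠ n : ℕ in atTop, ‖Real.log n ^ 3‖ ≤ 1 * ‖(n : ℝ)‖ :=
    ((Real.isLittleO_pow_log_id_atTop (n := 3)).comp_tendsto tendsto_natCast_atTop_atTop).bound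
      one_pos
  filter_upwards [h1, tendsto_log_natCast_atTop.eventually_ge_atTop (Real.exp 1),
    eventually_ge_atTop 1] with n h1 h2 hn
  have he := Real.exp_pos 1
  have hlog : 0 < Real.log n := he.trans_le h2
  have hn0 : (0 : ℝ) < n := by exact_mod_cast hn
  have hll : 1 ≤ Real.log (Real.log n) := (Real.le_log_iff_exp_le hlog).2 h2
  rw [Real.norm_of_nonneg (by positivity), Real.norm_of_nonneg hn0.le, one_mul] at h1
  rw [div_le_div_iff₀ hn0 (by positivity)]
  calc Real.log n * Real.log n ^ 2 = Real.log n ^ 3 := by ring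
    _ ≤ (n : ℝ) := h1
    _ ≤ _ := le_mul_of_one_le_left hn0.le hll

/-- With `l = log n` and `L = l - log l`, one has `r - L = log (l / r) ≤ l / r - 1 = log r / r ≤ 2 *
log l / l`; dividing by `L ≥ l / 2` gives the constant `4`. -/
theorem abs_lambertR_div_sub_one_le {n : ℕ} (hn : 1 ≤ n) (hlog : 4 ≤ Real.log n) :
    |lambertR n / Real.log (n / Real.log n) - 1| ≤
      4 * (Real.log (Real.log n) / Real.log n ^ 2) := by
  have hr0 := lambertR_pos hn
  have hn0 : (0 : ℝ) < n := by exact_mod_cast hn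
  have hl0 : 0 < Real.log n := by linarith
  have h2r := log_le_two_mul_lambertR hn
  have hadd := log_lambertR_add hn
  have hlr : 0 ≤ Real.log (lambertR n) := Real.log_nonneg (by linarith)
  have hrl : lambertR n ≤ Real.log n := by linarith
  have hll : Real.log (lambertR n) ≤ Real.log (Real.log n) := Real.log_le_log hr0 hrl
  set r := lambertR n with hr
  set l := Real.log n with hl
  have hL : Real.log (n / l) = l - Real.log l := Real.log_div hn0.ne' hl0.ne'
  have hLge : l / 2 ≤ Real.log (n / l) := by
    have h := Real.log_le_sub_one_of_pos (by positivity : 0 < l / 2)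
    rw [Real.log_div hl0.ne' two_ne_zero] at h
    have := Real.log_two_lt_d9
    rw [hL]; linarith
  have hdiff : r - Real.log (n / l) = Real.log (l / r) := by
    rw [hL, Real.log_div hl0.ne' hr0.ne']; linarith
  have hd0 : 0 ≤ r - Real.log (n / l) := by rw [hL]; linarith
  have hd1 : r - Real.log (n / l) ≤ 2 * Real.log l / l := by
    rw [hdiff]
    have h := Real.log_le_sub_one_of_pos (by positivity : 0 < l / r)
    have e : l / r - 1 = Real.log r / r := by field_simp; linarith
    rw [e] at h
    refine h.trans ?_
    rw [div_le_div_iff₀ hr0 hl0]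
    nlinarith
  have hLpos : 0 < Real.log (n / l) := by linarith
  have e : r / Real.log (n / l) - 1 = (r - Real.log (n / l)) / Real.log (n / l) := by field_simp
  rw [e, abs_of_nonneg (by positivity)]
  calc _ ≤ 2 * Real.log l / l / (l / 2) := by
        gcongr; exact hd0.trans hd1
    _ = _ := by field_simp; ring

theorem corollary4 :
    (∃ ε : ℕ → ℝ,
      ε =O[atTop] (fun n : ℕ => Real.log n / n) ∧
      ∀ n : ℕ, 2 ≤ n →
        (numRoughPartitions n 1 : ℝ) / numSetPartitions n = lambertR n / n * (1 + ε n)) ∧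
    (∃ δ : ℕ → ℝ,
      δ =O[atTop] (fun n : ℕ => Real.log (Real.log n) / (Real.log n) ^ 2) ∧
      ∀ n : ℕ, 2 ≤ n →
        (numRoughPartitions n 1 : ℝ) / numSetPartitions n =
          Real.log (n / Real.log n) / n * (1 + δ n)) := by
  simp only [numRoughPartitions_one_eq, numSetPartitions_eq_bell]
  -- Both error terms are obtained by solving the claimed identities for them, so only their sizes
  -- need an argument.
  refine ⟨⟨fun n => (singletonFreeBell n : ℝ) / Nat.bell n * (n / lambertR n) - 1, ?_, ?_⟩,
    ⟨fun n => (singletonFreeBell n : ℝ) / Nat.bell n * (n / Real.log (n / Real.log n)) - 1,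
      ?_, ?_⟩⟩
  · refine IsBigO.of_bound 4 ?_
    filter_upwards [eventually_abs_ratio_error_le] with n h
    rw [Real.norm_eq_abs]
    exact h.trans (by gcongr; exact le_abs_self _)
  · intro n hn
    have hr := (lambertR_pos (by omega : 1 ≤ n)).ne'
    have hn0 : (n : ℝ) ≠ 0 := by positivity
    field_simp
    ring
  · refine IsBigO.of_bound 12 ?_
    filter_upwards [eventually_abs_ratio_error_le, eventually_log_div_le,
      tendsto_log_natCast_atTop.eventually_ge_atTop 4, eventually_ge_atTop 4] with n h1 h2 h3 hn
    have hn1 : 1 ≤ n := by omega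
    have hr := lambertR_pos hn1
    have h4 := abs_lambertR_div_sub_one_le hn1 h3
    have hll : Real.log (Real.log n) / Real.log n ^ 2 ≤ 1 / 4 := by
      have := Real.log_le_sub_one_of_pos (by linarith : 0 < Real.log n)
      rw [div_le_iff₀ (by positivity)]
      nlinarith
    set q := (singletonFreeBell n : ℝ) / Nat.bell n
    set g := Real.log (Real.log n) / Real.log n ^ 2
    set ε := q * (n / lambertR n) - 1 with hε
    set d := lambertR n / Real.log (n / Real.log n) - 1 with hd
    -- The relative errors multiply as `(1 + d) * (1 + ε)`; with `|d| ≤ 1` this yields `4 + 2 * 4 =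
    -- 12`.
    have e : q * (n / Real.log (n / Real.log n)) - 1 = d + (1 + d) * ε := by
      rw [hε, hd]; field_simp; ring
    have h5 : |d| ≤ 1 := h4.trans (by linarith)
    rw [Real.norm_eq_abs, e]
    calc |d + (1 + d) * ε| ≤ |d| + |1 + d| * |ε| := by
          rw [← abs_mul]; exact abs_add_le _ _
      _ ≤ 4 * g + 2 * (4 * g) := by
          gcongr
          · exact (abs_add_le _ _).trans (by rw [abs_one]; linarith)
          · linarith
      _ = 12 * g := by ring
      _ ≤ _ := by gcongr; exact le_abs_self _
  · intro n hn
    have hn1 : (1 : ℝ) < n := by exact_mod_cast hn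
    have hl := Real.log_pos hn1
    have hlt : Real.log n < n := by linarith [Real.log_le_sub_one_of_pos (by linarith : (0 : ℝ) < n)]
    have hL : Real.log (n / Real.log n) ≠ 0 := (Real.log_pos ((one_lt_div hl).2 hlt)).ne'
    have hn0 : (n : ℝ) ≠ 0 := by positivity
    field_simp
    ring
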